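/- Call a function a classical solution of a third-order partial differential equation on an open set $\Omega\subseteq\mathbb{R}^2$ of points $(x,t)$ if it is of class $C^3$ on $\Omega$ and satisfies the equation at every point of $\Omega$. Consider, for positive functions $\phi(x,t)$, the equation \[ \phi^2\frac{\partial\phi}{\partial t}+\phi^2\frac{\partial^3\phi}{\partial x^3}-3\phi\frac{\partial\phi}{\partial x}\frac{\partial^2\phi}{\partial x^2}+2\left(\frac{\partial\phi}{\partial x}\right)^3-6\ln(\phi)\,\phi^2\frac{\partial\phi}{\partial x}=0. \tag{1} \] It is the transform of the Korteweg–de Vries equation $u_t+u_{xxx}-6uu_x=0$ under $u=\ln\phi$: on every open set $\Omega$, a positive function $\phi$ is a classical solution of (1) if and only if $u=\ln\phi$ is a classical solution of the Korteweg–de Vries equation. Equation (1) has the following positive classical solutions. (a) For every real $c\ge 0$, on all of $\mathbb{R}^2$, \[\phi(x,t)=\exp\left\{-\frac c2\,\mathrm{sech}^2\left[\frac{\sqrt c}{2}(x-ct)\right]\right\}.\] (b) For every natural number $N$, all real $\xi_1\ge\xi_2\ge\dots\ge\xi_N>0$ and all nonzero real $\beta_1,\dots,\beta_N$, with the $N\times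 N$ matrix \[A_{nm}(x,t)=\delta_{nm}+\frac{\beta_n\exp(8\xi_n^3t)\exp[-(\xi_n+\xi_m)x]}{\xi_n+\xi_m},\] the function \[\phi(x,t)=\exp\left\{-2\frac{\partial^2}{\partial x^2}\ln|\det A(x,t)|\right\}\] is a solution on the open set where $\det A(x,t)\neq0$. If all $\beta_n$ are positive, then $\det A(x,t)>0$ for all $(x,t)\in\mathbb{R}^2$, so that this is a solution on all of $\mathbb{R}^2$. (c) On all of $\mathbb{R}^2$, \[\phi(x,t)=\exp\left\{-12\,\frac{3+4\cosh(8t-2x)+\cosh(64t-4x)}{[\cosh(36t-3x)+3\cosh(28t-x)]^2}\right\},\] which satisfies $\phi(x,0)=\exp\{-6\,\mathrm{sech}^2(x)\}$ for all real $x$. -/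

import Mathlib

noncomputable section

namespace LogKdV

/-- The partial derivative in `t` of a function `u (x, t)`, written `u x t`. -/
def dt (u : ℝ → ℝ → ℝ) : ℝ → ℝ → ℝ := fun x t => deriv (fun s => u x s) t

/-- The partial derivative in `x` of a function `u (x, t)`, written `u x t`. -/
def dx (u : ℝ → ℝ → ℝ) : ℝ → ℝ → ℝ := fun x t => deriv (fun y => u y t) x

/-- `u` is a classical solution on the region `Ω` of the `(x, t)`-plane of the
Korteweg-de Vries equation `u_t + u_xxx - 6 u u_x = 0`. -/
structure IsKdVSolutionOn (u : ℝ → ℝ → ℝ) (Ω : Set (ℝ × ℝ)) : Prop where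
  contDiffOn : ContDiffOn ℝ 3 (fun p : ℝ × ℝ => u p.1 p.2) Ω
  equation : ∀ x t : ℝ, (x, t) ∈ Ω →
    dt u x t + dx (dx (dx u)) x t - 6 * u x t * dx u x t = 0

/-- `φ` is a classical (positive, so that `ln φ` makes sense) solution on the region `Ω` of
`φ² φ_t + φ² φ_xxx - 3 φ φ_x φ_xx + 2 φ_x³ - 6 ln(φ) φ² φ_x = 0`. -/
structure IsLogKdVSolutionOn (φ : ℝ → ℝ → ℝ) (Ω : Set (ℝ × ℝ)) : Prop where
  contDiffOn : ContDiffOn ℝ 3 (fun p : ℝ × ℝ => φ p.1 p.2) Ω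
  pos : ∀ x t : ℝ, (x, t) ∈ Ω → 0 < φ x t
  equation : ∀ x t : ℝ, (x, t) ∈ Ω →
    (φ x t) ^ 2 * dt φ x t
      + (φ x t) ^ 2 * dx (dx (dx φ)) x t
      - 3 * φ x t * dx φ x t * dx (dx φ) x t
      + 2 * (dx φ x t) ^ 3
      - 6 * Real.log (φ x t) * (φ x t) ^ 2 * dx φ x t = 0

/-- The one-soliton `-(c/2) sech² [(√c/2)(x - c t)]`. -/
def oneSoliton (c : ℝ) (x t : ℝ) : ℝ :=
  -(c / 2) * (1 / Real.cosh (Real.sqrt c / 2 * (x - c * t))) ^ 2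

/-- The matrix `A_nm = δ_nm + β_n exp(8 ξ_n³ t) exp(-(ξ_n + ξ_m) x) / (ξ_n + ξ_m)`. -/
def solitonMatrix {N : ℕ} (ξ β : Fin N → ℝ) (x t : ℝ) : Matrix (Fin N) (Fin N) ℝ :=
  Matrix.of fun n m =>
    (if n = m then 1 else 0)
      + β n * Real.exp (8 * (ξ n) ^ 3 * t) * Real.exp (-(ξ n + ξ m) * x) / (ξ n + ξ m)

/-- The `N`-soliton `-2 ∂²/∂x² ln det A(x, t)`; `Real.log` is `ln |·|`, so the formula has its
meaning wherever `det A(x, t) ≠ 0`. -/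
def nSoliton {N : ℕ} (ξ β : Fin N → ℝ) (x t : ℝ) : ℝ :=
  -2 * dx (dx fun y s => Real.log (solitonMatrix ξ β y s).det) x t

/-- The bisoliton. -/
def bisoliton (x t : ℝ) : ℝ :=
  -12 * ((3 + 4 * Real.cosh (8 * t - 2 * x) + Real.cosh (64 * t - 4 * x))
    / (Real.cosh (36 * t - 3 * x) + 3 * Real.cosh (28 * t - x)) ^ 2)

end LogKdV

end

noncomputable section

namespace LogKdV

open Filter Topology

/-! The left side of the equation for `φ` is `φ³` times the Korteweg-de Vries expression of `ln φ`,
so every solution comes from exponentiating a KdV solution.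

For the N-soliton, put `G = phaseMatrix`, `C = cauchyMatrix`, `Ξ = diagonal ξ`, `R = (1 + GC)⁻¹`.
Then `det A = det (1 + GC)`. Since `ΞC + CΞ` is the all-ones matrix and `Ξ` commutes with `G`, the
matrix `V = Ξ(GC) + (GC)Ξ` has rank one. Jacobi's formula gives `(ln det A)_x = -tr(RV)`, whence `u
= -4 tr(RΞRV)`. In `kdv_of_operator_system` all derivatives of `u` become traces of words in `R`,
`Ξ`, `V`; the rank-one property merges the two traces in `u u_x` into one, and the equation becomes
an identity between words.

Positivity of the determinant for `β > 0` follows from positive semidefiniteness of `C`. The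
bisoliton is the case `N = 2`, `ξ = (2, 1)`, `β = (12, 6)`; the one-soliton is checked directly. -/

/-! ### The logarithmic transform -/

theorem deriv_log_comp_iterate {f : ℝ → ℝ} {x : ℝ} (hf : ContDiffAt ℝ 3 f x) (hx : 0 < f x) :
    deriv (fun y => Real.log (f y)) x = deriv f x / f x ∧
    deriv (deriv (deriv (fun y => Real.log (f y)))) x =
      (f x ^ 2 * deriv (deriv (deriv f)) x - 3 * f x * deriv f x * deriv (deriv f) x
        + 2 * deriv f x ^ 3) / f x ^ 3 := by
  have hpos : ∀ᶠ y in 𝓝 x, 0 < f y := hf.continuousAt.eventually (lt_mem_nhds hx)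
  have hc : ∀ᶠ y in 𝓝 x, ContDiffAt ℝ 3 f y := hf.eventually (by simp)
  have d0 : ∀ y, ContDiffAt ℝ 3 f y → HasDerivAt f (deriv f y) y := fun y h =>
    (h.differentiableAt (by simp)).hasDerivAt
  have c1 : ∀ y, ContDiffAt ℝ 3 f y → ContDiffAt ℝ 2 (deriv f) y := fun y h =>
    h.derivWithin (by norm_num)
  have c2 : ∀ y, ContDiffAt ℝ 3 f y → ContDiffAt ℝ 1 (deriv (deriv f)) y := fun y h =>
    (c1 y h).derivWithin (by norm_num)
  have d1 : ∀ y, ContDiffAt ℝ 3 f y → HasDerivAt (deriv f) (deriv (deriv f) y) y := fun y h =>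
    ((c1 y h).differentiableAt (by simp)).hasDerivAt
  have d2 : ∀ y, ContDiffAt ℝ 3 f y →
      HasDerivAt (deriv (deriv f)) (deriv (deriv (deriv f)) y) y := fun y h =>
    ((c2 y h).differentiableAt (by simp)).hasDerivAt
  have e1 : ∀ᶠ y in 𝓝 x, deriv (fun y => Real.log (f y)) y = deriv f y / f y := by
    filter_upwards [hpos, hc] with y hy hcy
    exact ((d0 y hcy).log hy.ne').deriv
  have e2 : ∀ᶠ y in 𝓝 x, deriv (deriv (fun y => Real.log (f y))) y =
      (deriv (deriv f) y * f y - deriv f y * deriv f y) / f y ^ 2 := by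
    filter_upwards [hpos, hc, e1.eventually_nhds] with y hy hcy h1
    rw [EventuallyEq.deriv_eq h1]
    exact ((d1 y hcy).fun_div (d0 y hcy) hy.ne').deriv
  refine ⟨e1.self_of_nhds, ?_⟩
  rw [EventuallyEq.deriv_eq e2]
  have h := (((d2 x hf).fun_mul (d0 x hf)).fun_sub ((d1 x hf).fun_mul (d1 x hf))).fun_div
    ((d0 x hf).fun_pow 2) (pow_ne_zero 2 hx.ne')
  rw [h.deriv]
  field_simp
  ring

theorem isLogKdVSolutionOn_iff_log {Ω : Set (ℝ × ℝ)} {φ : ℝ → ℝ → ℝ} (hΩ : IsOpen Ω)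
    (hpos : ∀ x t : ℝ, (x, t) ∈ Ω → 0 < φ x t) :
    IsLogKdVSolutionOn φ Ω ↔ IsKdVSolutionOn (fun x t => Real.log (φ x t)) Ω := by
  have key : ContDiffOn ℝ 3 (fun p : ℝ × ℝ => φ p.1 p.2) Ω → ∀ x t, (x, t) ∈ Ω →
      (φ x t) ^ 2 * dt φ x t + (φ x t) ^ 2 * dx (dx (dx φ)) x t
      - 3 * φ x t * dx φ x t * dx (dx φ) x t + 2 * (dx φ x t) ^ 3
      - 6 * Real.log (φ x t) * (φ x t) ^ 2 * dx φ x t =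
      φ x t ^ 3 * (dt (fun x t => Real.log (φ x t)) x t +
        dx (dx (dx fun x t => Real.log (φ x t))) x t -
        6 * Real.log (φ x t) * dx (fun x t => Real.log (φ x t)) x t) := by
    intro h x t hxt
    have hc := h.contDiffAt (hΩ.mem_nhds hxt)
    have hp := hpos x t hxt
    have hx : ContDiffAt ℝ 3 (fun y => φ y t) x :=
      hc.comp (f := fun y => (y, t)) x (contDiffAt_id.prodMk contDiffAt_const)
    have ht : ContDiffAt ℝ 3 (fun s => φ x s) t :=
      hc.comp (f := fun s => (x, s)) t (contDiffAt_const.prodMk contDiffAt_id)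
    obtain ⟨h1, h3⟩ := deriv_log_comp_iterate hx hp
    obtain ⟨h2, -⟩ := deriv_log_comp_iterate ht hp
    simp only [dt, dx]
    rw [h1, h2, h3]
    field_simp
    ring
  constructor
  · rintro ⟨hc, -, he⟩
    refine ⟨hc.log fun p hp => (hpos p.1 p.2 hp).ne', fun x t hxt => ?_⟩
    have := he x t hxt
    rw [key hc x t hxt] at this
    exact (mul_eq_zero.1 this).resolve_left (pow_ne_zero 3 (hpos x t hxt).ne')
  · rintro ⟨hc, he⟩
    have hc' : ContDiffOn ℝ 3 (fun p : ℝ × ℝ => φ p.1 p.2) Ω :=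
      hc.exp.congr fun p hp => (Real.exp_log (hpos p.1 p.2 hp)).symm
    refine ⟨hc', hpos, fun x t hxt => ?_⟩
    rw [key hc' x t hxt, he x t hxt, mul_zero]

theorem IsKdVSolutionOn.exp {Ω : Set (ℝ × ℝ)} {u : ℝ → ℝ → ℝ} (hΩ : IsOpen Ω)
    (h : IsKdVSolutionOn u Ω) : IsLogKdVSolutionOn (fun x t => Real.exp (u x t)) Ω := by
  rw [isLogKdVSolutionOn_iff_log hΩ fun x t _ => Real.exp_pos _]
  simpa only [Real.log_exp] using h

/-! ### Partial derivatives on an open set -/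

theorem dx_eq {u : ℝ → ℝ → ℝ} {x t a : ℝ} (h : HasDerivAt (fun y => u y t) a x) : dx u x t = a :=
  h.deriv

theorem dt_eq {u : ℝ → ℝ → ℝ} {x t a : ℝ} (h : HasDerivAt (fun s => u x s) a t) : dt u x t = a :=
  h.deriv

theorem dx_congr {Ω : Set (ℝ × ℝ)} (hΩ : IsOpen Ω) {u v : ℝ → ℝ → ℝ}
    (h : ∀ x t, (x, t) ∈ Ω → u x t = v x t) : ∀ x t, (x, t) ∈ Ω → dx u x t = dx v x t := by
  intro x t hxt
  refine EventuallyEq.deriv_eq ?_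
  have hc : ContinuousAt (fun y : ℝ => (y, t)) x := by fun_prop
  filter_upwards [hc.eventually (hΩ.mem_nhds hxt)] with y hy using h y t hy

theorem dt_congr {Ω : Set (ℝ × ℝ)} (hΩ : IsOpen Ω) {u v : ℝ → ℝ → ℝ}
    (h : ∀ x t, (x, t) ∈ Ω → u x t = v x t) : ∀ x t, (x, t) ∈ Ω → dt u x t = dt v x t := by
  intro x t hxt
  refine EventuallyEq.deriv_eq ?_
  have hc : ContinuousAt (fun s : ℝ => (x, s)) t := by fun_prop
  filter_upwards [hc.eventually (hΩ.mem_nhds hxt)] with y hy using h x y hy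

theorem IsKdVSolutionOn.congr {Ω : Set (ℝ × ℝ)} (hΩ : IsOpen Ω) {u v : ℝ → ℝ → ℝ}
    (hv : IsKdVSolutionOn v Ω) (h : ∀ x t, (x, t) ∈ Ω → u x t = v x t) : IsKdVSolutionOn u Ω where
  contDiffOn := hv.contDiffOn.congr fun p hp => h p.1 p.2 hp
  equation x t hxt := by
    rw [dt_congr hΩ h x t hxt, h x t hxt, dx_congr hΩ h x t hxt,
      dx_congr hΩ (dx_congr hΩ (dx_congr hΩ h)) x t hxt]
    exact hv.equation x t hxt

/-! ### The one-soliton -/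

theorem isKdVSolutionOn_oneSoliton {c : ℝ} (hc : 0 ≤ c) :
    IsKdVSolutionOn (oneSoliton c) Set.univ := by
  obtain ⟨k, rfl, hk⟩ : ∃ k : ℝ, c = 4 * k ^ 2 ∧ Real.sqrt c / 2 = k :=
    ⟨Real.sqrt c / 2, by rw [div_pow, Real.sq_sqrt hc]; ring, rfl⟩
  -- `T` is tanh of the phase. Both its partial derivatives are multiples of `1 - T²`, so every term
  -- of the equation is a polynomial in `T`.
  set T : ℝ → ℝ → ℝ := fun x t => Real.sinh (k * (x - 4 * k ^ 2 * t)) /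
    Real.cosh (k * (x - 4 * k ^ 2 * t)) with hT
  have hu : oneSoliton (4 * k ^ 2) = fun x t => -(2 * k ^ 2) * (1 - T x t ^ 2) := by
    funext x t
    simp only [oneSoliton, hk, hT]
    have h := Real.cosh_sq (k * (x - 4 * k ^ 2 * t))
    have hp := (Real.cosh_pos (k * (x - 4 * k ^ 2 * t))).ne'
    field_simp
    linear_combination 4 * k ^ 2 * h
  have hTx : ∀ x t, HasDerivAt (fun y => T y t) (k * (1 - T x t ^ 2)) x := fun x t => by
    have hp := (Real.cosh_pos (k * (x - 4 * k ^ 2 * t))).ne'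
    have ha : HasDerivAt (fun y => k * (y - 4 * k ^ 2 * t)) (k * 1) x :=
      ((hasDerivAt_id x).sub_const _).const_mul k
    refine (ha.sinh.fun_div ha.cosh hp).congr_deriv ?_
    simp only [hT]
    field_simp
  have hTt : ∀ x t, HasDerivAt (fun s => T x s) (-4 * k ^ 3 * (1 - T x t ^ 2)) t := fun x t => by
    have hp := (Real.cosh_pos (k * (x - 4 * k ^ 2 * t))).ne'
    have ha : HasDerivAt (fun s => k * (x - 4 * k ^ 2 * s)) (k * -(4 * k ^ 2 * 1)) t :=
      (((hasDerivAt_id t).const_mul _).const_sub _).const_mul k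
    refine (ha.sinh.fun_div ha.cosh hp).congr_deriv ?_
    simp only [hT]
    field_simp
    ring
  have h1 : dx (oneSoliton (4 * k ^ 2)) = fun x t => 4 * k ^ 3 * (T x t - T x t ^ 3) := by
    funext x t
    rw [hu]
    refine dx_eq (((((hTx x t).fun_pow 2).const_sub 1).const_mul _).congr_deriv ?_)
    push_cast
    ring
  have h2 : dx (dx (oneSoliton (4 * k ^ 2))) =
      fun x t => 4 * k ^ 4 * (1 - 4 * T x t ^ 2 + 3 * T x t ^ 4) := by
    funext x t
    rw [h1]
    refine dx_eq ((((hTx x t).fun_sub ((hTx x t).fun_pow 3)).const_mul _).congr_deriv ?_)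
    push_cast
    ring
  have h3 : ∀ x t, dx (dx (dx (oneSoliton (4 * k ^ 2)))) x t =
      4 * k ^ 5 * (-8 * T x t + 12 * T x t ^ 3) * (1 - T x t ^ 2) := by
    intro x t
    rw [h2]
    refine dx_eq (((((((hTx x t).fun_pow 2).const_mul 4).const_sub 1).fun_add
      (((hTx x t).fun_pow 4).const_mul 3)).const_mul _).congr_deriv ?_)
    push_cast
    ring
  have h4 : ∀ x t, dt (oneSoliton (4 * k ^ 2)) x t =
      -16 * k ^ 5 * T x t * (1 - T x t ^ 2) := by
    intro x t
    rw [hu]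
    refine dt_eq (((((hTt x t).fun_pow 2).const_sub 1).const_mul _).congr_deriv ?_)
    push_cast
    ring
  refine ⟨?_, fun x t _ => ?_⟩
  · unfold oneSoliton
    refine ContDiff.contDiffOn ?_
    have : ∀ p : ℝ × ℝ, Real.cosh (√(4 * k ^ 2) / 2 * (p.1 - 4 * k ^ 2 * p.2)) ≠ 0 :=
      fun p => (Real.cosh_pos _).ne'
    have hcosh : ContDiff ℝ 3
        (fun p : ℝ × ℝ => Real.cosh (√(4 * k ^ 2) / 2 * (p.1 - 4 * k ^ 2 * p.2))) := by
      fun_prop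
    exact contDiff_const.mul ((contDiff_const.div hcosh this).pow 2)
  · rw [h4, h3, h1, hu]
    ring

/-! ### The KdV equation from an operator system -/

section Algebra

variable {𝔸 : Type*} [NormedRing 𝔸] [NormedAlgebra ℝ 𝔸]

/-- With `R = (1 + B)⁻¹`, one has `R' = -R(ΞB)R` and `BR = 1 - R`, which eliminates `B`. `Ξ` and `B`
need not commute. It serves both variables, with `-2Ξ` for `x` and `8Ξ³` for `t`. -/
theorem hasDerivAt_ringInverse_one_add [HasSummableGeomSeries 𝔸] {B : ℝ → 𝔸} {Ξ : 𝔸} {x : ℝ}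
    (hu : IsUnit (1 + B x)) (hB : HasDerivAt B (Ξ * B x) x) :
    HasDerivAt (fun y => Ring.inverse (1 + B y))
      (Ring.inverse (1 + B x) * Ξ * Ring.inverse (1 + B x) - Ring.inverse (1 + B x) * Ξ) x := by
  obtain ⟨a, ha⟩ := hu
  have h := hasFDerivAt_ringInverse (𝕜 := ℝ) a
  rw [ha] at h
  refine (h.comp_hasDerivAt x (hB.const_add 1)).congr_deriv ?_
  rw [← ha, Ring.inverse_unit]
  have hb : B x = a - 1 := by rw [ha]; abel
  simp [hb, mul_sub, sub_mul, mul_assoc]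

theorem hasDerivAt_apply_mul_of_operator_system (τ : 𝔸 →L[ℝ] ℝ) {Ξ : 𝔸} {R V : ℝ → 𝔸} {x : ℝ}
    (hR : HasDerivAt R ((2 : ℝ) • (R x * Ξ) - (2 : ℝ) • (R x * Ξ * R x)) x)
    (hV : HasDerivAt V (-(2 : ℝ) • (Ξ * V x)) x) :
    HasDerivAt (fun y => τ (R y * V y)) (-2 * τ (R x * Ξ * R x * V x)) x := by
  refine (τ.hasFDerivAt.comp_hasDerivAt x (hR.fun_mul hV)).congr_deriv ?_
  simp only [sub_mul, smul_mul_assoc, mul_smul_comm, mul_assoc, map_add, map_sub, map_smul,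
    smul_eq_mul]
  ring

/-- `hτ` abstracts the trace against a rank-one `V`. Together with `hRVR` it turns a product of two
values of `τ` into values of `τ` on words with a single, final `V`. Neither cyclicity of `τ` nor
commutation of `Ξ` with `V` is required. -/
theorem kdv_of_operator_system {Ω : Set (ℝ × ℝ)} (hΩ : IsOpen Ω) (τ : 𝔸 →L[ℝ] ℝ) (Ξ : 𝔸)
    (R V : ℝ → ℝ → 𝔸)
    (hRx : ∀ x t, (x, t) ∈ Ω → HasDerivAt (fun y => R y t)
      ((2 : ℝ) • (R x t * Ξ) - (2 : ℝ) • (R x t * Ξ * R x t)) x)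
    (hRt : ∀ x t, (x, t) ∈ Ω → HasDerivAt (fun s => R x s)
      ((8 : ℝ) • (R x t * Ξ ^ 3 * R x t) - (8 : ℝ) • (R x t * Ξ ^ 3)) t)
    (hVx : ∀ x t, HasDerivAt (fun y => V y t) (-(2 : ℝ) • (Ξ * V x t)) x)
    (hVt : ∀ x t, HasDerivAt (fun s => V x s) ((8 : ℝ) • (Ξ ^ 3 * V x t)) t)
    (hτ : ∀ x t X Y, τ (X * V x t) * τ (Y * V x t) = τ (X * V x t * (Y * V x t)))
    (hRVR : ∀ x t, (x, t) ∈ Ω → R x t * V x t * R x t =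
      R x t * Ξ + Ξ * R x t - (2 : ℝ) • (R x t * Ξ * R x t)) (x t : ℝ) (hxt : (x, t) ∈ Ω) :
    dt (fun x t => -4 * τ (R x t * Ξ * R x t * V x t)) x t +
      dx (dx (dx (fun x t => -4 * τ (R x t * Ξ * R x t * V x t)))) x t -
      6 * (-4 * τ (R x t * Ξ * R x t * V x t)) *
      dx (fun x t => -4 * τ (R x t * Ξ * R x t * V x t)) x t = 0 := by
  have d {X : ℝ → 𝔸} {X' : 𝔸} {x t : ℝ} (h : HasDerivAt X X' x) :
      HasDerivAt (fun y => τ (X y * V y t)) (τ (X' * V x t) - 2 * τ (X x * Ξ * V x t)) x := by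
    refine (τ.hasFDerivAt.comp_hasDerivAt x (h.fun_mul (hVx x t))).congr_deriv ?_
    simp [mul_assoc, sub_eq_add_neg]
  have e1 : ∀ x t, (x, t) ∈ Ω → dx (fun x t => -4 * τ (R x t * Ξ * R x t * V x t)) x t =
      -8 * τ (R x t * Ξ ^ 2 * R x t * V x t) +
        16 * τ (R x t * Ξ * R x t * Ξ * R x t * V x t) := by
    intro x t h
    have r := hRx x t h
    refine dx_eq (((d ((r.mul_const Ξ).fun_mul r)).const_mul _).congr_deriv ?_)
    simp only [mul_assoc, mul_sub, mul_add, sub_mul, add_mul, smul_mul_assoc, mul_smul_comm,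
      map_add, map_sub, map_smul, smul_eq_mul, pow_succ, pow_zero, one_mul]
    ring
  have e2 : ∀ x t, (x, t) ∈ Ω → dx (dx (fun x t => -4 * τ (R x t * Ξ * R x t * V x t))) x t =
      -16 * τ (R x t * Ξ ^ 3 * R x t * V x t) +
        48 * τ (R x t * Ξ ^ 2 * R x t * Ξ * R x t * V x t) +
        48 * τ (R x t * Ξ * R x t * Ξ ^ 2 * R x t * V x t) -
        96 * τ (R x t * Ξ * R x t * Ξ * R x t * Ξ * R x t * V x t) := by
    intro x t h
    rw [dx_congr hΩ e1 x t h]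
    have r := hRx x t h
    refine dx_eq ((((d ((r.mul_const (Ξ ^ 2)).fun_mul r)).const_mul _).fun_add
      ((d ((((r.mul_const Ξ).fun_mul r).mul_const Ξ).fun_mul r)).const_mul _)).congr_deriv ?_)
    simp only [mul_assoc, mul_sub, mul_add, sub_mul, add_mul, smul_mul_assoc, mul_smul_comm,
      map_add, map_sub, map_smul, smul_eq_mul, pow_succ, pow_zero, one_mul]
    ring
  have e3 : dx (dx (dx (fun x t => -4 * τ (R x t * Ξ * R x t * V x t)))) x t =
      -32 * τ (R x t * Ξ ^ 4 * R x t * V x t) +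
        128 * τ (R x t * Ξ * R x t * Ξ ^ 3 * R x t * V x t) +
        128 * τ (R x t * Ξ ^ 3 * R x t * Ξ * R x t * V x t) +
        192 * τ (R x t * Ξ ^ 2 * R x t * Ξ ^ 2 * R x t * V x t) -
        384 * τ (R x t * Ξ * R x t * Ξ ^ 2 * R x t * Ξ * R x t * V x t) -
        384 * τ (R x t * Ξ ^ 2 * R x t * Ξ * R x t * Ξ * R x t * V x t) -
        384 * τ (R x t * Ξ * R x t * Ξ * R x t * Ξ ^ 2 * R x t * V x t) +
        768 * τ (R x t * Ξ * R x t * Ξ * R x t * Ξ * R x t * Ξ * R x t * V x t) := by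
    rw [dx_congr hΩ e2 x t hxt]
    have r := hRx x t hxt
    refine dx_eq ((((((d ((r.mul_const (Ξ ^ 3)).fun_mul r)).const_mul _).fun_add
      ((d ((((r.mul_const (Ξ ^ 2)).fun_mul r).mul_const Ξ).fun_mul r)).const_mul _)).fun_add
      ((d ((((r.mul_const Ξ).fun_mul r).mul_const (Ξ ^ 2)).fun_mul r)).const_mul _)).fun_sub
      ((d ((((((r.mul_const Ξ).fun_mul r).mul_const Ξ).fun_mul r).mul_const Ξ).fun_mul
        r)).const_mul _)).congr_deriv ?_)
    simp only [mul_assoc, mul_sub, mul_add, sub_mul, add_mul, smul_mul_assoc, mul_smul_comm,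
      map_add, map_sub, map_smul, smul_eq_mul, pow_succ, pow_zero, one_mul]
    ring
  have e4 : dt (fun x t => -4 * τ (R x t * Ξ * R x t * V x t)) x t =
      -4 * (8 * τ (R x t * Ξ ^ 3 * R x t * Ξ * R x t * V x t) +
        8 * τ (R x t * Ξ * R x t * Ξ ^ 3 * R x t * V x t) -
        8 * τ (R x t * Ξ ^ 4 * R x t * V x t)) := by
    have r := hRt x t hxt
    refine dt_eq (((τ.hasFDerivAt.comp_hasDerivAt t
      (((r.mul_const Ξ).fun_mul r).fun_mul (hVt x t))).const_mul _).congr_deriv ?_)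
    simp only [mul_assoc, mul_sub, mul_add, sub_mul, add_mul, smul_mul_assoc, mul_smul_comm,
      map_add, map_sub, map_smul, smul_eq_mul, pow_succ, pow_zero, one_mul]
    ring
  have prod : ∀ X Y : 𝔸, τ (X * R x t * V x t) * τ (R x t * Y * V x t) =
      τ (X * R x t * Ξ * Y * V x t) + τ (X * Ξ * R x t * Y * V x t) -
        2 * τ (X * R x t * Ξ * R x t * Y * V x t) := by
    intro X Y
    rw [hτ, show X * R x t * V x t * (R x t * Y * V x t) =
      X * (R x t * V x t * R x t) * Y * V x t by simp only [mul_assoc], hRVR x t hxt]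
    simp only [mul_assoc, mul_sub, mul_add, sub_mul, add_mul, smul_mul_assoc, mul_smul_comm,
      map_add, map_sub, map_smul, smul_eq_mul]
  -- The products in `u u_x` are each expanded in both orders of the factors (`p1`, `p2` and `p3`,
  -- `p4`). Without cyclicity the resulting words differ, and it is the average of the two
  -- expansions that matches the linear terms.
  have p1 := prod (R x t * Ξ) (Ξ ^ 2 * R x t)
  have p2 := prod (R x t * Ξ ^ 2) (Ξ * R x t)
  have p3 := prod (R x t * Ξ) (Ξ * R x t * Ξ * R x t)
  have p4 := prod (R x t * Ξ * R x t * Ξ) (Ξ * R x t)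
  rw [e1 x t hxt, e3, e4]
  simp only [mul_assoc, pow_succ, pow_zero, one_mul] at p1 p2 p3 p4 ⊢
  linear_combination (-96 : ℝ) * p1 - 96 * p2 + 192 * p3 + 192 * p4

end Algebra

/-! ### Determinants, traces and the Cauchy matrix -/

section Matrices

open Matrix

/-- Jacobi's formula: differentiating the Leibniz expansion column by column gives determinants with
one column replaced by that of `A'`, which Cramer's rule reads as diagonal entries of `adj(A) A'`.
-/
theorem hasDerivAt_det {n : Type*} [Fintype n] [DecidableEq n] {A : ℝ → Matrix n n ℝ}
    {A' : Matrix n n ℝ} {x : ℝ} (h : ∀ i j, HasDerivAt (fun y => A y i j) (A' i j) x) :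
    HasDerivAt (fun y => (A y).det) ((A x).adjugate * A').trace x := by
  have h1 : HasDerivAt (fun y => (A y).det) (∑ σ : Equiv.Perm n, (Equiv.Perm.sign σ : ℝ) *
      ∑ i, (∏ j ∈ Finset.univ.erase i, A x (σ j) j) * A' (σ i) i) x := by
    simp only [det_apply']
    exact HasDerivAt.fun_sum fun σ _ =>
      (HasDerivAt.fun_finsetProd fun i _ => h (σ i) i).const_mul _
  refine h1.congr_deriv ?_
  simp only [Finset.mul_sum]
  rw [Finset.sum_comm]
  refine Finset.sum_congr rfl fun i _ => ?_
  have h2 : ((A x).adjugate * A') i i = (A x).cramer (fun k => A' k i) i := by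
    rw [cramer_eq_adjugate_mulVec]
    rfl
  rw [diag_apply, h2, cramer_apply, det_apply']
  refine Finset.sum_congr rfl fun σ _ => ?_
  rw [← Finset.mul_prod_erase Finset.univ _ (Finset.mem_univ i), updateCol_self, mul_comm (A' _ _)]
  congr 2
  refine Finset.prod_congr rfl fun j hj => ?_
  rw [updateCol_ne (Finset.ne_of_mem_erase hj)]

theorem trace_mul_vecMulVec_mul_trace {n : Type*} [Fintype n] (v w : n → ℝ)
    (X Y : Matrix n n ℝ) :
    (X * vecMulVec v w).trace * (Y * vecMulVec v w).trace =
      (X * vecMulVec v w * (Y * vecMulVec v w)).trace := by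
  simp only [mul_vecMulVec, trace_vecMulVec, vecMulVec_mulVec, smul_dotProduct, op_smul_eq_smul,
    smul_eq_mul]
  rw [mul_comm, dotProduct_comm w]

/-- The Cauchy matrix `1 / (ξ_n + ξ_m)`. -/
def cauchyMatrix {N : ℕ} (ξ : Fin N → ℝ) : Matrix (Fin N) (Fin N) ℝ :=
  of fun n m => 1 / (ξ n + ξ m)

/-- The quadratic form at `v` is `∫₀^∞ (∑ vₙ exp(-ξₙ s))² ds`. To avoid the integral, `f` is its
tail from `s` on: it has derivative minus the square, tends to `0`, and hence is nonnegative at `0`.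
-/
theorem posSemidef_cauchyMatrix {N : ℕ} {ξ : Fin N → ℝ} (hξ : ∀ n, 0 < ξ n) :
    (cauchyMatrix ξ).PosSemidef := by
  rw [posSemidef_iff_dotProduct_mulVec]
  refine ⟨by ext i j; simp [cauchyMatrix, add_comm], fun v => ?_⟩
  set f : ℝ → ℝ := fun s => ∑ n, ∑ m, v n * v m * (Real.exp (-(ξ n + ξ m) * s) / (ξ n + ξ m))
    with hf
  have hpos : ∀ n m, 0 < ξ n + ξ m := fun n m => add_pos (hξ n) (hξ m)
  have hd : ∀ s, HasDerivAt f (-(∑ n, v n * Real.exp (-ξ n * s)) ^ 2) s := by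
    intro s
    have : HasDerivAt f (∑ n, ∑ m, v n * v m *
        (Real.exp (-(ξ n + ξ m) * s) * (-(ξ n + ξ m) * 1) / (ξ n + ξ m))) s :=
      HasDerivAt.fun_sum fun n _ => HasDerivAt.fun_sum fun m _ =>
        ((((hasDerivAt_id s).const_mul _).exp).div_const _).const_mul _
    refine this.congr_deriv ?_
    rw [sq, Finset.sum_mul_sum, ← Finset.sum_neg_distrib]
    refine Finset.sum_congr rfl fun n _ => ?_
    rw [← Finset.sum_neg_distrib]
    refine Finset.sum_congr rfl fun m _ => ?_
    have := (hpos n m).ne'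
    rw [show -(ξ n + ξ m) * s = -ξ n * s + -ξ m * s by ring, Real.exp_add]
    field_simp
  have hanti : Antitone f := antitone_of_hasDerivAt_nonpos hd fun s => by
    simpa using sq_nonneg (∑ n, v n * Real.exp (-ξ n * s))
  have hlim : Tendsto f atTop (𝓝 (∑ n, ∑ m, v n * v m * (0 / (ξ n + ξ m)))) := by
    refine tendsto_finsetSum _ fun n _ => tendsto_finsetSum _ fun m _ => ?_
    refine ((Real.tendsto_exp_atBot.comp ?_).div_const _).const_mul _
    exact tendsto_id.const_mul_atTop_of_neg (neg_neg_of_pos (hpos n m))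
  have h0 := hanti.le_of_tendsto hlim 0
  simp only [zero_div, mul_zero, Finset.sum_const_zero] at h0
  refine h0.trans_eq ?_
  simp only [hf, dotProduct, mulVec, cauchyMatrix, Finset.mul_sum, of_apply, star_trivial]
  refine Finset.sum_congr rfl fun n _ => Finset.sum_congr rfl fun m _ => ?_
  simp
  ring

variable {N : ℕ}

/-- The diagonal matrix with entries `β_n exp(8 ξ_n³ t - 2 ξ_n x)`. -/
def phaseMatrix (ξ β : Fin N → ℝ) (x t : ℝ) : Matrix (Fin N) (Fin N) ℝ :=
  diagonal fun n => β n * Real.exp (8 * ξ n ^ 3 * t - 2 * ξ n * x)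

/-- The two matrices are conjugate by `diag(exp(ξₙ x))`, which moves the whole `x`-dependence into a
left diagonal factor. -/
theorem det_solitonMatrix (ξ β : Fin N → ℝ) (x t : ℝ) :
    (solitonMatrix ξ β x t).det = (1 + phaseMatrix ξ β x t * cauchyMatrix ξ).det := by
  have h : solitonMatrix ξ β x t = diagonal (fun n => Real.exp (ξ n * x)) *
      (1 + phaseMatrix ξ β x t * cauchyMatrix ξ) * diagonal (fun n => Real.exp (-ξ n * x)) := by
    have hd : diagonal (fun n => Real.exp (ξ n * x)) * diagonal (fun n => Real.exp (-ξ n * x)) =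
        (1 : Matrix (Fin N) (Fin N) ℝ) := by
      rw [diagonal_mul_diagonal, ← diagonal_one]
      congr 1
      funext n
      rw [← Real.exp_add]
      simp
    rw [mul_add, mul_one, add_mul, hd]
    ext n m
    simp only [solitonMatrix, phaseMatrix, cauchyMatrix, of_apply, Matrix.add_apply, one_apply,
      mul_diagonal, diagonal_mul]
    congr 1
    rw [show -(ξ n + ξ m) * x = ξ n * x + -2 * ξ n * x + -ξ m * x by ring, sub_eq_add_neg,
      Real.exp_add, Real.exp_add, Real.exp_add, show -2 * ξ n * x = -(2 * ξ n * x) by ring]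
    ring
  rw [h, det_mul, det_mul, det_diagonal, det_diagonal, mul_right_comm, ← Finset.prod_mul_distrib]
  simp [← Real.exp_add]

/-- For `β > 0` the phase matrix is a square `D²`, and `det(1 + D·DC) = det(1 + DCD)` with `DCD`
positive semidefinite. -/
theorem det_solitonMatrix_pos {ξ β : Fin N → ℝ} (hξ : ∀ n, 0 < ξ n) (hβ : ∀ n, 0 < β n)
    (x t : ℝ) : 0 < (solitonMatrix ξ β x t).det := by
  set d : Fin N → ℝ := fun n => Real.sqrt (β n * Real.exp (8 * ξ n ^ 3 * t - 2 * ξ n * x)) with hd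
  have h : phaseMatrix ξ β x t = diagonal d * diagonal d := by
    rw [diagonal_mul_diagonal, phaseMatrix]
    congr 1
    funext n
    exact (Real.mul_self_sqrt (mul_pos (hβ n) (Real.exp_pos _)).le).symm
  rw [det_solitonMatrix, h, mul_assoc, det_one_add_mul_comm]
  refine (PosDef.one.add_posSemidef ?_).det_pos
  simpa using (posSemidef_cauchyMatrix hξ).mul_mul_conjTranspose_same (diagonal d)

-- Matrix calculus and the N-soliton, with a submultiplicative norm

attribute [local instance] Matrix.linftyOpNormedRing Matrix.linftyOpNormedAlgebra

theorem hasDerivAt_diagonal {n : Type*} [Fintype n] [DecidableEq n] {f : ℝ → n → ℝ} {f' : n → ℝ}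
    {x : ℝ} (h : ∀ i, HasDerivAt (fun y => f y i) (f' i) x) :
    HasDerivAt (fun y => diagonal (f y)) (diagonal f') x :=
  (LinearMap.toContinuousLinearMap (diagonalLinearMap n ℝ ℝ)).hasFDerivAt.comp_hasDerivAt x
    (hasDerivAt_pi.2 h)

theorem hasDerivAt_apply_of_matrix {n : Type*} [Fintype n] [DecidableEq n]
    {A : ℝ → Matrix n n ℝ} {A' : Matrix n n ℝ} {x : ℝ} (h : HasDerivAt A A' x) (i j : n) :
    HasDerivAt (fun y => A y i j) (A' i j) x :=
  (LinearMap.toContinuousLinearMap (entryLinearMap ℝ ℝ i j)).hasFDerivAt.comp_hasDerivAt x h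

theorem hasDerivAt_phaseMatrix_fst (ξ β : Fin N → ℝ) (x t : ℝ) :
    HasDerivAt (fun y => phaseMatrix ξ β y t)
      (-(2 : ℝ) • (diagonal ξ * phaseMatrix ξ β x t)) x := by
  refine (hasDerivAt_diagonal (f' := fun n => _) fun n =>
    (((hasDerivAt_id x).const_mul _).const_sub _).exp.const_mul _).congr_deriv ?_
  rw [phaseMatrix, diagonal_mul_diagonal, ← diagonal_smul]
  congr 1
  funext n
  simp
  ring

theorem hasDerivAt_phaseMatrix_snd (ξ β : Fin N → ℝ) (x t : ℝ) :
    HasDerivAt (fun s => phaseMatrix ξ β x s)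
      ((8 : ℝ) • (diagonal ξ ^ 3 * phaseMatrix ξ β x t)) t := by
  refine (hasDerivAt_diagonal (f' := fun n => _) fun n =>
    (((hasDerivAt_id t).const_mul _).sub_const _).exp.const_mul _).congr_deriv ?_
  rw [phaseMatrix, diagonal_pow, diagonal_mul_diagonal, ← diagonal_smul]
  congr 1
  funext n
  simp
  ring

theorem contDiff_phaseMatrix (ξ β : Fin N → ℝ) :
    ContDiff ℝ 3 fun p : ℝ × ℝ => phaseMatrix ξ β p.1 p.2 :=
  (LinearMap.toContinuousLinearMap (diagonalLinearMap (Fin N) ℝ ℝ)).contDiff.comp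
    (contDiff_pi.2 fun n => by fun_prop)

theorem isOpen_det_solitonMatrix_ne_zero (ξ β : Fin N → ℝ) :
    IsOpen {p : ℝ × ℝ | (solitonMatrix ξ β p.1 p.2).det ≠ 0} := by
  refine isOpen_ne_fun ?_ continuous_const
  simp only [det_solitonMatrix]
  exact (continuous_const.add
    ((contDiff_phaseMatrix ξ β).continuous.mul continuous_const)).matrix_det

theorem commute_diagonal_phaseMatrix (ξ β : Fin N → ℝ) (x t : ℝ) :
    diagonal ξ * phaseMatrix ξ β x t = phaseMatrix ξ β x t * diagonal ξ := by
  simp only [phaseMatrix, diagonal_mul_diagonal, mul_comm]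

theorem diagonal_mul_cauchyMatrix_add {ξ : Fin N → ℝ} (hξ : ∀ n, 0 < ξ n) :
    diagonal ξ * cauchyMatrix ξ + cauchyMatrix ξ * diagonal ξ = vecMulVec 1 1 := by
  ext n m
  have := (add_pos (hξ n) (hξ m)).ne'
  simp only [Matrix.add_apply, diagonal_mul, mul_diagonal, cauchyMatrix, of_apply, vecMulVec_apply,
    Pi.one_apply]
  field_simp

theorem isKdVSolutionOn_nSoliton {ξ : Fin N → ℝ} (hξ : ∀ n, 0 < ξ n) (β : Fin N → ℝ) :
    IsKdVSolutionOn (nSoliton ξ β) {p : ℝ × ℝ | (solitonMatrix ξ β p.1 p.2).det ≠ 0} := by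
  set Ω := {p : ℝ × ℝ | (solitonMatrix ξ β p.1 p.2).det ≠ 0}
  have hΩ : IsOpen Ω := isOpen_det_solitonMatrix_ne_zero ξ β
  set Ξ : Matrix (Fin N) (Fin N) ℝ := diagonal ξ
  set G := phaseMatrix ξ β
  set C := cauchyMatrix ξ
  set R : ℝ → ℝ → Matrix (Fin N) (Fin N) ℝ := fun x t => Ring.inverse (1 + G x t * C) with hR
  set V : ℝ → ℝ → Matrix (Fin N) (Fin N) ℝ := fun x t => G x t * vecMulVec 1 1 with hV
  have hdet : ∀ x t, (solitonMatrix ξ β x t).det = (1 + G x t * C).det := det_solitonMatrix ξ β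
  have hunit : ∀ x t, (x, t) ∈ Ω → IsUnit (1 + G x t * C) := fun x t h => by
    rw [isUnit_iff_isUnit_det, isUnit_iff_ne_zero, ← hdet]
    exact h
  have hRl : ∀ x t, (x, t) ∈ Ω → R x t * (1 + G x t * C) = 1 := fun x t h =>
    Ring.inverse_mul_cancel _ (hunit x t h)
  have hRr : ∀ x t, (x, t) ∈ Ω → (1 + G x t * C) * R x t = 1 := fun x t h =>
    Ring.mul_inverse_cancel _ (hunit x t h)
  have hRB : ∀ x t, (x, t) ∈ Ω → R x t * (G x t * C) = 1 - R x t := fun x t h => by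
    rw [← hRl x t h]; noncomm_ring
  have hBR : ∀ x t, (x, t) ∈ Ω → G x t * C * R x t = 1 - R x t := fun x t h => by
    rw [← hRr x t h]; noncomm_ring
  have hVB : ∀ x t, V x t = Ξ * (G x t * C) + G x t * C * Ξ := fun x t => by
    have hc : Ξ * G x t = G x t * Ξ := commute_diagonal_phaseMatrix ξ β x t
    simp only [hV, ← diagonal_mul_cauchyMatrix_add hξ]
    rw [mul_add, ← mul_assoc, ← mul_assoc, ← mul_assoc, hc]
  have hBx : ∀ x t, HasDerivAt (fun y => G y t * C) (-(2 : ℝ) • (Ξ * (G x t * C))) x :=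
    fun x t => ((hasDerivAt_phaseMatrix_fst ξ β x t).mul_const C).congr_deriv (by
      simp only [smul_mul_assoc, mul_assoc]; rfl)
  have hBt : ∀ x t, HasDerivAt (fun s => G x s * C) ((8 : ℝ) • (Ξ ^ 3 * (G x t * C))) t :=
    fun x t => ((hasDerivAt_phaseMatrix_snd ξ β x t).mul_const C).congr_deriv (by
      simp only [smul_mul_assoc, mul_assoc]; rfl)
  have hVx : ∀ x t, HasDerivAt (fun y => V y t) (-(2 : ℝ) • (Ξ * V x t)) x :=
    fun x t => ((hasDerivAt_phaseMatrix_fst ξ β x t).mul_const _).congr_deriv (by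
      simp only [smul_mul_assoc, mul_assoc]; rfl)
  have hVt : ∀ x t, HasDerivAt (fun s => V x s) ((8 : ℝ) • (Ξ ^ 3 * V x t)) t :=
    fun x t => ((hasDerivAt_phaseMatrix_snd ξ β x t).mul_const _).congr_deriv (by
      simp only [smul_mul_assoc, mul_assoc]; rfl)
  have hRx : ∀ x t, (x, t) ∈ Ω → HasDerivAt (fun y => R y t)
      ((2 : ℝ) • (R x t * Ξ) - (2 : ℝ) • (R x t * Ξ * R x t)) x := fun x t h =>
    (hasDerivAt_ringInverse_one_add (Ξ := -(2 : ℝ) • Ξ) (hunit x t h)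
      ((hBx x t).congr_deriv (smul_mul_assoc _ _ _).symm)).congr_deriv (by
        simp only [neg_smul, mul_neg, neg_mul, mul_smul_comm, smul_mul_assoc, hR]; abel)
  have hRt : ∀ x t, (x, t) ∈ Ω → HasDerivAt (fun s => R x s)
      ((8 : ℝ) • (R x t * Ξ ^ 3 * R x t) - (8 : ℝ) • (R x t * Ξ ^ 3)) t := fun x t h =>
    (hasDerivAt_ringInverse_one_add (Ξ := (8 : ℝ) • Ξ ^ 3) (hunit x t h)
      ((hBt x t).congr_deriv (smul_mul_assoc _ _ _).symm)).congr_deriv (by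
        simp only [mul_smul_comm, smul_mul_assoc, hR])
  have hRVR : ∀ x t, (x, t) ∈ Ω → R x t * V x t * R x t =
      R x t * Ξ + Ξ * R x t - (2 : ℝ) • (R x t * Ξ * R x t) := fun x t h => by
    rw [hVB, mul_add, add_mul, ← mul_assoc (R x t) (G x t * C) Ξ, hRB x t h,
      mul_assoc (R x t) (Ξ * _) (R x t), mul_assoc Ξ, hBR x t h, two_smul]
    noncomm_ring
  set τ : Matrix (Fin N) (Fin N) ℝ →L[ℝ] ℝ :=
    LinearMap.toContinuousLinearMap (traceLinearMap (Fin N) ℝ ℝ)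
  have hτ : ∀ x t X Y, τ (X * V x t) * τ (Y * V x t) = τ (X * V x t * (Y * V x t)) :=
    fun x t X Y => by
      rw [show V x t = vecMulVec (G x t *ᵥ 1) 1 from mul_vecMulVec _ _ _]
      exact trace_mul_vecMulVec_mul_trace (G x t *ᵥ 1) 1 X Y
  have e1 : ∀ x t, (x, t) ∈ Ω →
      dx (fun y s => Real.log (solitonMatrix ξ β y s).det) x t = -τ (R x t * V x t) := by
    intro x t h
    have hne : (1 + G x t * C).det ≠ 0 := hdet x t ▸ h
    simp only [hdet]
    refine dx_eq (((hasDerivAt_det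
      (hasDerivAt_apply_of_matrix ((hBx x t).const_add 1))).log hne).congr_deriv ?_)
    have hinv : R x t = (1 + G x t * C).det⁻¹ • (1 + G x t * C).adjugate := by
      simp only [hR]
      rw [← nonsing_inv_eq_ringInverse, inv_def, Ring.inverse_eq_inv']
    -- `R` commutes with `GC`, so both halves of `V` contribute equally to `tr(RV)`.
    have hcyc : (R x t * (G x t * C * Ξ)).trace = (R x t * (Ξ * (G x t * C))).trace := by
      rw [← mul_assoc, hRB x t h, ← hBR x t h, mul_assoc (G x t * C), trace_mul_comm, mul_assoc]
    have h2 : τ (R x t * V x t) = 2 * (R x t * (Ξ * (G x t * C))).trace := by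
      rw [hVB, mul_add, map_add, two_mul]
      exact congrArg₂ (· + ·) rfl hcyc
    rw [h2, hinv, smul_mul_assoc, trace_smul, mul_smul_comm, trace_smul, smul_eq_mul, smul_eq_mul]
    ring
  have e2 : ∀ x t, (x, t) ∈ Ω → nSoliton ξ β x t = -4 * τ (R x t * Ξ * R x t * V x t) := by
    intro x t h
    have h1 : dx (dx fun y s => Real.log (solitonMatrix ξ β y s).det) x t =
        2 * τ (R x t * Ξ * R x t * V x t) := by
      rw [dx_congr hΩ e1 x t h]
      exact dx_eq ((hasDerivAt_apply_mul_of_operator_system τ (hRx x t h)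
        (hVx x t)).fun_neg.congr_deriv (by
          rw [neg_mul, neg_neg]; rfl))
    rw [nSoliton, h1]
    ring
  refine IsKdVSolutionOn.congr hΩ ⟨fun p hp => ?_, fun x t h => ?_⟩ e2
  · have hG : ContDiffAt ℝ 3 (fun p : ℝ × ℝ => G p.1 p.2) p :=
      (contDiff_phaseMatrix ξ β).contDiffAt
    have hRc : ContDiffAt ℝ 3 (fun p : ℝ × ℝ => R p.1 p.2) p := by
      obtain ⟨a, ha⟩ := hunit p.1 p.2 hp
      have := contDiffAt_ringInverse ℝ (n := 3) a
      rw [ha] at this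
      exact this.comp p (contDiffAt_const.add (hG.mul contDiffAt_const))
    exact (contDiffAt_const.mul (τ.contDiff.contDiffAt.comp p
      (((hRc.mul contDiffAt_const).mul hRc).mul (hG.mul contDiffAt_const)))).contDiffWithinAt
  · exact kdv_of_operator_system hΩ τ Ξ R V hRx hRt hVx hVt hτ hRVR x t h

end Matrices

/-! ### The bisoliton -/

/-- With `a = 36t - 3x`, `b = 28t - x`, the values of `β` make the determinant `1 + 3e^(a+b) +
3e^(a-b) + e^(2a)`, which is symmetric after factoring out `e^a`. -/
theorem det_bisoliton (x t : ℝ) : (solitonMatrix ![2, 1] ![12, 6] x t).det =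
    2 * Real.exp (36 * t - 3 * x) * (Real.cosh (36 * t - 3 * x) + 3 * Real.cosh (28 * t - x)) := by
  have e1 : Real.exp (8 * 2 ^ 3 * t - 2 * 2 * x) =
      Real.exp (36 * t - 3 * x) * Real.exp (28 * t - x) := by
    rw [← Real.exp_add]; congr 1; ring
  have e2 : Real.exp (8 * t - 2 * x) = Real.exp (36 * t - 3 * x) * (Real.exp (28 * t - x))⁻¹ := by
    rw [← Real.exp_neg, ← Real.exp_add]; congr 1; ring
  rw [det_solitonMatrix, Matrix.det_fin_two, Real.cosh_eq, Real.cosh_eq, Real.exp_neg, Real.exp_neg]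
  simp only [phaseMatrix, cauchyMatrix, Matrix.add_apply, Matrix.one_apply, Matrix.diagonal_mul,
    Matrix.of_apply, Matrix.cons_val_zero, Matrix.cons_val_one, one_pow, mul_one, e1, e2,
    Fin.isValue, reduceIte, zero_ne_one, one_ne_zero]
  have := Real.exp_ne_zero (36 * t - 3 * x)
  have := Real.exp_ne_zero (28 * t - x)
  field_simp
  ring

theorem nSoliton_eq_bisoliton (x t : ℝ) : nSoliton ![2, 1] ![12, 6] x t = bisoliton x t := by
  have hF : ∀ x t : ℝ, 0 < Real.cosh (36 * t - 3 * x) + 3 * Real.cosh (28 * t - x) := fun x t =>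
    add_pos (Real.cosh_pos _) (mul_pos three_pos (Real.cosh_pos _))
  -- The prefactor `2e^a` contributes only an affine function of `x`, which the second derivative
  -- kills.
  have h0 : (fun y s => Real.log (solitonMatrix ![2, 1] ![12, 6] y s).det) = fun x t =>
      Real.log 2 + (36 * t - 3 * x) +
        Real.log (Real.cosh (36 * t - 3 * x) + 3 * Real.cosh (28 * t - x)) := by
    funext x t
    rw [det_bisoliton, Real.log_mul (by positivity) (hF x t).ne',
      Real.log_mul two_ne_zero (Real.exp_pos _).ne', Real.log_exp]
  have ha : ∀ x t : ℝ, HasDerivAt (fun y : ℝ => 36 * t - 3 * y) (-(3 * 1)) x := fun x t =>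
    ((hasDerivAt_id x).const_mul _).const_sub _
  have hb : ∀ x t : ℝ, HasDerivAt (fun y : ℝ => 28 * t - y) (-1) x := fun x t =>
    (hasDerivAt_id x).const_sub _
  have h1 : dx (fun y s => Real.log (solitonMatrix ![2, 1] ![12, 6] y s).det) = fun x t =>
      -3 + -3 * (Real.sinh (36 * t - 3 * x) + Real.sinh (28 * t - x)) /
        (Real.cosh (36 * t - 3 * x) + 3 * Real.cosh (28 * t - x)) := by
    funext x t
    rw [h0]
    refine dx_eq ((((ha x t).const_add _).fun_add
      (((ha x t).cosh.fun_add ((hb x t).cosh.const_mul 3)).log (hF x t).ne')).congr_deriv ?_)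
    ring
  have h2 : dx (dx (fun y s => Real.log (solitonMatrix ![2, 1] ![12, 6] y s).det)) x t =
      ((9 * Real.cosh (36 * t - 3 * x) + 3 * Real.cosh (28 * t - x)) *
        (Real.cosh (36 * t - 3 * x) + 3 * Real.cosh (28 * t - x)) -
        9 * (Real.sinh (36 * t - 3 * x) + Real.sinh (28 * t - x)) ^ 2) /
      (Real.cosh (36 * t - 3 * x) + 3 * Real.cosh (28 * t - x)) ^ 2 := by
    rw [h1]
    refine dx_eq ((((((ha x t).sinh.fun_add (hb x t).sinh).const_mul (-3)).fun_div
      ((ha x t).cosh.fun_add ((hb x t).cosh.const_mul 3)) (hF x t).ne').const_add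
        (-3)).congr_deriv ?_)
    ring
  rw [nSoliton, h2, bisoliton, show 8 * t - 2 * x = (36 * t - 3 * x) - (28 * t - x) by ring,
    show 64 * t - 4 * x = (36 * t - 3 * x) + (28 * t - x) by ring, Real.cosh_sub (36 * t - 3 * x),
    Real.cosh_add (36 * t - 3 * x)]
  have ca := Real.cosh_sq (36 * t - 3 * x)
  have cb := Real.cosh_sq (28 * t - x)
  rw [← mul_div_assoc, ← mul_div_assoc]
  congr 1
  linear_combination (-18) * ca - 18 * cb

theorem isKdVSolutionOn_bisoliton : IsKdVSolutionOn bisoliton Set.univ := by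
  have hξ : ∀ n, (0 : ℝ) < (![2, 1] : Fin 2 → ℝ) n := by
    intro n; fin_cases n <;> norm_num
  have hβ : ∀ n, (0 : ℝ) < (![12, 6] : Fin 2 → ℝ) n := by
    intro n; fin_cases n <;> norm_num
  have h := isKdVSolutionOn_nSoliton hξ ![12, 6]
  rw [Set.eq_univ_of_forall fun p : ℝ × ℝ => (det_solitonMatrix_pos hξ hβ p.1 p.2).ne'] at h
  exact h.congr isOpen_univ fun x t _ => (nSoliton_eq_bisoliton x t).symm

theorem bisoliton_zero_right (x : ℝ) : bisoliton x 0 = -6 * (1 / Real.cosh x) ^ 2 := by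
  have hc := (Real.cosh_pos x).ne'
  have h3 : Real.cosh (36 * 0 - 3 * x) = 4 * Real.cosh x ^ 3 - 3 * Real.cosh x := by
    rw [← Real.cosh_three_mul, ← Real.cosh_neg]; congr 1; ring
  have h1 : Real.cosh (28 * 0 - x) = Real.cosh x := by
    rw [← Real.cosh_neg]; congr 1; ring
  have h2 : Real.cosh (8 * 0 - 2 * x) = 2 * Real.cosh x ^ 2 - 1 := by
    rw [← Real.cosh_neg, show -(8 * 0 - 2 * x) = 2 * x by ring, Real.cosh_two_mul, Real.sinh_sq]
    ring
  have h4 : Real.cosh (64 * 0 - 4 * x) = 2 * (2 * Real.cosh x ^ 2 - 1) ^ 2 - 1 := by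
    rw [← Real.cosh_neg, show -(64 * 0 - 4 * x) = 2 * (2 * x) by ring, Real.cosh_two_mul,
      Real.sinh_sq, Real.cosh_two_mul, Real.sinh_sq]
    ring
  rw [bisoliton, h1, h2, h3, h4]
  field_simp
  ring

end LogKdV

end

theorem proposition27 :
    -- the equation for `φ` is the transform of the Korteweg-de Vries equation under `u = ln φ`
    (∀ (Ω : Set (ℝ × ℝ)) (φ : ℝ → ℝ → ℝ), IsOpen Ω →
      (∀ x t : ℝ, (x, t) ∈ Ω → 0 < φ x t) →
      (LogKdV.IsLogKdVSolutionOn φ Ω ↔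
        LogKdV.IsKdVSolutionOn (fun x t => Real.log (φ x t)) Ω)) ∧
    -- the exponential of the one-soliton
    (∀ c : ℝ, 0 ≤ c →
      LogKdV.IsLogKdVSolutionOn (fun x t => Real.exp (LogKdV.oneSoliton c x t)) Set.univ) ∧
    -- the exponential of the N-soliton, wherever the determinant does not vanish
    (∀ (N : ℕ) (ξ β : Fin N → ℝ), Antitone ξ → (∀ n, 0 < ξ n) → (∀ n, β n ≠ 0) →
      LogKdV.IsLogKdVSolutionOn (fun x t => Real.exp (LogKdV.nSoliton ξ β x t))
        {p : ℝ × ℝ | (LogKdV.solitonMatrix ξ β p.1 p.2).det ≠ 0} ∧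
      -- which is everywhere if the parameters `β` are positive
      ((∀ n, 0 < β n) → ∀ x t : ℝ, 0 < (LogKdV.solitonMatrix ξ β x t).det)) ∧
    -- the exponential of the bisoliton with initial condition `u(x,0) = -6 sech² x`
    (LogKdV.IsLogKdVSolutionOn (fun x t => Real.exp (LogKdV.bisoliton x t)) Set.univ ∧
      ∀ x : ℝ, Real.exp (LogKdV.bisoliton x 0)
        = Real.exp (-6 * (1 / Real.cosh x) ^ 2)) :=
  ⟨fun _ _ hΩ hpos => LogKdV.isLogKdVSolutionOn_iff_log hΩ hpos,
    fun _ hc => (LogKdV.isKdVSolutionOn_oneSoliton hc).exp isOpen_univ,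
    fun _ ξ β _ hξ _ => ⟨(LogKdV.isKdVSolutionOn_nSoliton hξ β).exp
      (LogKdV.isOpen_det_solitonMatrix_ne_zero ξ β),
      fun hβ => LogKdV.det_solitonMatrix_pos hξ hβ⟩,
    LogKdV.isKdVSolutionOn_bisoliton.exp isOpen_univ,
    fun x => congrArg Real.exp (LogKdV.bisoliton_zero_right x)⟩
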